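/- Notation. For $A\in\mathbb{R}^{d_{\rm out}\times d_{\rm in}}$ and $q=\min(d_{\rm out},d_{\rm in})$, let $\sigma_1(A)\ge\dots\ge\sigma_q(A)\ge 0$ be its singular values, $\|A\|_{\rm F}$ its Frobenius norm, $\|A\|_*=\sum_{i=1}^q\sigma_i(A)$ its nuclear norm and $\|A\|_{(k)}=\sum_{i=1}^k\sigma_i(A)$ its Ky Fan $k$-norm. Matrices $U\in\mathbb{R}^{d_{\rm out}\times k}$, $V\in\mathbb{R}^{d_{\rm in}\times k}$ contain top-$k$ singular vectors of $A$ if $U^\top U=V^\top V=I_k$, $AV=US_k$ and $A^\top U=VS_k$, where $S_k=\mathrm{diag}(\sigma_1(A),\dots,\sigma_k(A))$ (they need not be unique); in this case $A_k:=US_kV^\top$ is a best rank-$k$ approximation of $A$. Theorem (Nonconvex Nuclear-Norm Stationarity). Let $1\le k\le q$, $b\ge1$, $T\ge1$, $\beta\in[0,1)$, $\gamma>0$, $\nu\ge0$. Let $f:\mathbb{R}^{d_{\rm out}\times d_{\rm in}}\to\mathbb{R}$ be differentiable and $L$-smooth with respect to the Frobenius norm: $\|\nabla f(W)-\nabla f(W')\|_{\rm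 F}\le L\|W-W'\|_{\rm F}$ for all $W,W'$. Let the random matrices $(W_t)_{t\ge0}$, $(M_t)_{t\ge0}$ be generated by NuMuon with batch size $b$, momentum parameter $\beta$ and constant stepsize $\gamma$, that is, for all $t\ge0$, $$G_t=\frac1b\sum_{i=1}^b\nabla f(W_t;\xi_{t,i}),\qquad M_0=G_0,\qquad M_t=\beta M_{t-1}+(1-\beta)G_t\ \ (t\ge1),\qquad W_{t+1}=W_t-\gamma\,U_{t,k}V_{t,k}^\top,$$ where $\nabla f(W;\xi)$ is the stochastic gradient computed from the sample $\xi$, and $U_{t,k},V_{t,k}$ contain top-$k$ left and right singular vectors of $M_t$. Let $(\mathcal F_t)_{t\ge0}$ be a filtration such that $W_t$ is $\mathcal F_t$-measurable and $G_t$ is integrable and $\mathcal F_{t+1}$-measurable, and assume that for all $t$ the stochastic gradient is unbiased given the past with variance at most $\nu^2/b$: $$\mathbb{E}[G_t\mid\mathcal F_t]=\nabla f(W_t)\ \text{ almost surely},\qquad \mathbb{E}\|G_t-\nabla f(W_t)\|_{\rm F}^2\le\frac{\nu^2}{b}.$$ Then $f(W_0)-f(W_T)$ and, for $t<T$, $\|\nabla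 f(W_t)\|_{(k)}$ and $\|\nabla f(W_t)\|_*$ are integrable, and $$\frac1T\sum_{t=0}^{T-1}\mathbb{E}\|\nabla f(W_t)\|_{(k)}\le\frac{\mathbb{E}[f(W_0)-f(W_T)]}{T\gamma}+\frac{Lk\gamma}{2}+\frac{2\nu\sqrt{k(1-\beta)}}{\sqrt{(1+\beta)b}}+\frac{2\beta\nu\sqrt k}{(1-\beta)T\sqrt b}+\frac{2k\gamma\beta L}{1-\beta}.$$ If, moreover, $\delta_k$ satisfies $\mathbb{E}\|\nabla f(W_t)-(\nabla f(W_t))_k\|_*\le\delta_k$ for all $t\in\{0,\dots,T-1\}$, then $$\frac1T\sum_{t=0}^{T-1}\mathbb{E}\|\nabla f(W_t)\|_{*}\le\frac{\mathbb{E}[f(W_0)-f(W_T)]}{T\gamma}+\frac{Lk\gamma}{2}+\frac{2\nu\sqrt{k(1-\beta)}}{\sqrt{(1+\beta)b}}+\frac{2\beta\nu\sqrt k}{(1-\beta)T\sqrt b}+\frac{2k\gamma\beta L}{1-\beta}+\delta_k.$$ -/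

import Mathlib

open MeasureTheory

namespace NuMuon

/-- The Frobenius norm. -/
noncomputable def frobNorm {m n : ℕ} (A : Matrix (Fin m) (Fin n) ℝ) : ℝ :=
  √(∑ i, ∑ j, A i j ^ 2)

/-- The gradient of `f` at `W` for the Frobenius inner product: the matrix of partial
derivatives of `f` with respect to the entries of `W`. -/
noncomputable def grad {m n : ℕ} (f : Matrix (Fin m) (Fin n) ℝ → ℝ)
    (W : Matrix (Fin m) (Fin n) ℝ) : Matrix (Fin m) (Fin n) ℝ :=
  Matrix.of fun i j => fderiv ℝ f W (Matrix.single i j 1)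

/-- `f` is `L`-smooth with respect to the Frobenius norm. -/
structure IsLSmooth {m n : ℕ} (f : Matrix (Fin m) (Fin n) ℝ → ℝ) (L : ℝ) : Prop where
  differentiable : Differentiable ℝ f
  frobNorm_grad_sub_le : ∀ W W' : Matrix (Fin m) (Fin n) ℝ,
    frobNorm (grad f W - grad f W') ≤ L * frobNorm (W - W')

/-- The singular values of `A` in decreasing order, indexed from `0` (so `sv A 0` is the largest),
continued by zeros beyond the index `min m n - 1`. -/
noncomputable def sv {m n : ℕ} (A : Matrix (Fin m) (Fin n) ℝ) (i : ℕ) : ℝ :=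
  (Matrix.toEuclideanLin A).singularValues i

/-- The nuclear norm: the sum of all singular values. -/
noncomputable def nuclearNorm {m n : ℕ} (A : Matrix (Fin m) (Fin n) ℝ) : ℝ :=
  ∑ i ∈ Finset.range (min m n), sv A i

/-- The Ky Fan `k`-norm: the sum of the `k` largest singular values. -/
noncomputable def kyFanNorm {m n : ℕ} (k : ℕ) (A : Matrix (Fin m) (Fin n) ℝ) : ℝ :=
  ∑ i ∈ Finset.range k, sv A i

/-- The columns of `U` and `V` are top-`k` left and right singular vectors of `A`: they are
orthonormal, and the `i`-th columns form a singular pair for the `i`-th largest singular value.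
(In case of ties, or if `A` has rank less than `k`, there are several choices.) -/
structure IsTopSingularVectors {m n k : ℕ} (A : Matrix (Fin m) (Fin n) ℝ)
    (U : Matrix (Fin m) (Fin k) ℝ) (V : Matrix (Fin n) (Fin k) ℝ) : Prop where
  left_orthonormal : U.transpose * U = 1
  right_orthonormal : V.transpose * V = 1
  mul_right : A * V = U * Matrix.diagonal fun i : Fin k => sv A i
  transpose_mul_left : A.transpose * U = V * Matrix.diagonal fun i : Fin k => sv A i

/-- `B` is a best rank-`k` approximation of `A`, that is, a rank-`k` truncation `U_k S_k V_kᵀ` of a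
singular value decomposition of `A`. -/
def IsRankTruncation {m n : ℕ} (k : ℕ) (A B : Matrix (Fin m) (Fin n) ℝ) : Prop :=
  ∃ (U : Matrix (Fin m) (Fin k) ℝ) (V : Matrix (Fin n) (Fin k) ℝ),
    IsTopSingularVectors A U V ∧
      B = U * (Matrix.diagonal fun i : Fin k => sv A i) * V.transpose

/-- The mini-batch gradient `(1/b) ∑ᵢ g(W, ξᵢ)`, where `g(W, ξ)` is the stochastic gradient at `W`
computed from the sample `ξ`. -/
noncomputable def batchGradient {m n b : ℕ} {Ξ : Type*}
    (g : Matrix (Fin m) (Fin n) ℝ → Ξ → Matrix (Fin m) (Fin n) ℝ)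
    (W : Matrix (Fin m) (Fin n) ℝ) (ξ : Fin b → Ξ) : Matrix (Fin m) (Fin n) ℝ :=
  (b : ℝ)⁻¹ • ∑ i, g W (ξ i)

/-- The momentum buffer: `M₀ = G₀` and `Mₜ = β Mₜ₋₁ + (1 - β) Gₜ`. -/
noncomputable def momentum {m n : ℕ} (β : ℝ) (G : ℕ → Matrix (Fin m) (Fin n) ℝ) :
    ℕ → Matrix (Fin m) (Fin n) ℝ
  | 0 => G 0
  | t + 1 => β • momentum β G t + (1 - β) • G (t + 1)

/-- The sequence `W` is generated by NuMuon from the stochastic gradients `G`, with rank `k`,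
momentum parameter `β` and constant stepsize `γ`: at each step, `W (t + 1) = W t - γ U_k V_kᵀ` for
some top-`k` singular vectors `U_k`, `V_k` of the momentum buffer. -/
def IsNuMuonRun {m n : ℕ} (k : ℕ) (β γ : ℝ) (G W : ℕ → Matrix (Fin m) (Fin n) ℝ) : Prop :=
  ∀ t, ∃ (U : Matrix (Fin m) (Fin k) ℝ) (V : Matrix (Fin n) (Fin k) ℝ),
    IsTopSingularVectors (momentum β G t) U V ∧ W (t + 1) = W t - γ • (U * V.transpose)

/-- The random matrices `G t` are unbiased estimators of `grad f (W t)`, conditionally on the past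
`ℱ t` (which determines the iterate `W t`), with variance at most `v`. Measurability, integrability
and conditional expectations of random matrices are understood entrywise. -/
structure IsStochasticGradient {m n : ℕ} {Ω : Type*} {mΩ : MeasurableSpace Ω} (μ : Measure Ω)
    (ℱ : Filtration ℕ mΩ) (f : Matrix (Fin m) (Fin n) ℝ → ℝ)
    (W G : ℕ → Ω → Matrix (Fin m) (Fin n) ℝ) (v : ℝ) : Prop where
  iterate_measurable : ∀ t i j, Measurable[ℱ t] fun ω => W t ω i j
  estimator_measurable : ∀ t i j, Measurable[ℱ (t + 1)] fun ω => G t ω i j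
  integrable : ∀ t i j, Integrable (fun ω => G t ω i j) μ
  unbiased : ∀ t i j, μ[fun ω => G t ω i j | ℱ t] =ᵐ[μ] fun ω => grad f (W t ω) i j
  integrable_sq : ∀ t, Integrable (fun ω => frobNorm (G t ω - grad f (W t ω)) ^ 2) μ
  variance_le : ∀ t, ∫ ω, frobNorm (G t ω - grad f (W t ω)) ^ 2 ∂μ ≤ v

end NuMuon

namespace NuMuon

open Matrix

/-! One step is analysed pathwise. Since `U * Vᵀ` has Frobenius norm `√k`, the descent lemma shows
that a step decreases `f` by at least `γ ⟨∇f, U Vᵀ⟩ - L k γ² / 2`. For the momentum `M` itself, `⟨M,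
U Vᵀ⟩` equals the Ky Fan norm of `M`, and Ky Fan's maximum principle makes that norm `√k`-Lipschitz
for the Frobenius norm. Passing from `M` to `∇f` therefore costs `√k ‖M - ∇f‖` twice
(`IsLSmooth.kyFanNorm_grad_le`).

By linearity of the momentum average, `M - ∇f` is the average of the gradient noise plus the lag of
the averaged true gradients. Successive gradients differ by at most `L γ √k`, so the lag is at most
`β L γ √k / (1 - β)`. The noise is a martingale difference sequence, so its second moments add with
squared weights. They approach the stationary level `(1 - β) / (1 + β) * ν² / b`, and the transient
caused by `M₀ = G₀` adds at most `β ^ (t + 1) * ν / √b` to the first moment, which is summable.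
Summing over `t` telescopes the decrease of `f`.

The nuclear norm statement follows from the exact identity `‖A - A_k‖_* = ‖A‖_* - ‖A‖_(k)`, proved
by duality between the nuclear norm and contractions. -/

/-- The Frobenius inner product. -/
noncomputable def frobInner {m n : ℕ} (A B : Matrix (Fin m) (Fin n) ℝ) : ℝ :=
  ∑ i, ∑ j, A i j * B i j

/-! ### Frobenius inner product and norm. -/

section FrobeniusInner

variable {m n : ℕ}

theorem frobInner_eq_trace (A B : Matrix (Fin m) (Fin n) ℝ) :
    frobInner A B = (Aᵀ * B).trace := by
  rw [frobInner, Finset.sum_comm]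
  simp [trace, mul_apply]

theorem frobInner_comm (A B : Matrix (Fin m) (Fin n) ℝ) : frobInner A B = frobInner B A := by
  simp only [frobInner, mul_comm]

theorem frobInner_add_right (A B C : Matrix (Fin m) (Fin n) ℝ) :
    frobInner A (B + C) = frobInner A B + frobInner A C := by
  simp [frobInner, mul_add, Finset.sum_add_distrib]

theorem frobInner_sub_left (A B C : Matrix (Fin m) (Fin n) ℝ) :
    frobInner (A - B) C = frobInner A C - frobInner B C := by
  simp [frobInner, sub_mul, Finset.sum_sub_distrib]

theorem frobInner_smul_left (c : ℝ) (A B : Matrix (Fin m) (Fin n) ℝ) :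
    frobInner (c • A) B = c * frobInner A B := by
  simp [frobInner, Finset.mul_sum, mul_assoc]

theorem frobInner_smul_right (c : ℝ) (A B : Matrix (Fin m) (Fin n) ℝ) :
    frobInner A (c • B) = c * frobInner A B := by
  rw [frobInner_comm, frobInner_smul_left, frobInner_comm]

theorem frobNorm_nonneg (A : Matrix (Fin m) (Fin n) ℝ) : 0 ≤ frobNorm A := Real.sqrt_nonneg _

theorem frobNorm_sq (A : Matrix (Fin m) (Fin n) ℝ) : frobNorm A ^ 2 = frobInner A A := by
  rw [frobNorm, Real.sq_sqrt (by positivity)]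
  simp only [frobInner, sq]

/-- The entries of a matrix as a vector of a Euclidean space. -/
noncomputable def euclideanVec (A : Matrix (Fin m) (Fin n) ℝ) :
    EuclideanSpace ℝ (Fin m × Fin n) :=
  WithLp.toLp 2 fun p => A p.1 p.2

theorem norm_euclideanVec (A : Matrix (Fin m) (Fin n) ℝ) : ‖euclideanVec A‖ = frobNorm A := by
  simp [EuclideanSpace.norm_eq, euclideanVec, frobNorm, Fintype.sum_prod_type]

theorem frobInner_le (A B : Matrix (Fin m) (Fin n) ℝ) :
    frobInner A B ≤ frobNorm A * frobNorm B := by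
  have h := real_inner_le_norm (euclideanVec A) (euclideanVec B)
  rw [norm_euclideanVec, norm_euclideanVec] at h
  refine le_of_eq_of_le ?_ h
  simp [PiLp.inner_apply, euclideanVec, Fintype.sum_prod_type, frobInner, mul_comm]

theorem frobNorm_add_le (A B : Matrix (Fin m) (Fin n) ℝ) :
    frobNorm (A + B) ≤ frobNorm A + frobNorm B := by
  simp only [← norm_euclideanVec]
  exact norm_add_le (euclideanVec A) (euclideanVec B)

theorem frobNorm_smul (c : ℝ) (A : Matrix (Fin m) (Fin n) ℝ) :
    frobNorm (c • A) = |c| * frobNorm A := by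
  simp only [← norm_euclideanVec]
  exact norm_smul c (euclideanVec A)

theorem frobNorm_neg (A : Matrix (Fin m) (Fin n) ℝ) : frobNorm (-A) = frobNorm A := by
  simp [frobNorm]

theorem frobNorm_sub_comm (A B : Matrix (Fin m) (Fin n) ℝ) :
    frobNorm (A - B) = frobNorm (B - A) := by
  rw [← frobNorm_neg, neg_sub]

theorem abs_frobInner_le (A B : Matrix (Fin m) (Fin n) ℝ) :
    |frobInner A B| ≤ frobNorm A * frobNorm B := by
  refine abs_le.2 ⟨?_, frobInner_le A B⟩
  have h := frobInner_le ((-1 : ℝ) • A) B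
  rw [frobInner_smul_left, frobNorm_smul] at h
  simp at h
  linarith

theorem abs_apply_le_frobNorm (A : Matrix (Fin m) (Fin n) ℝ) (i : Fin m) (j : Fin n) :
    |A i j| ≤ frobNorm A := by
  rw [← norm_euclideanVec]
  exact PiLp.norm_apply_le (euclideanVec A) (i, j)

theorem continuous_frobNorm : Continuous (frobNorm : Matrix (Fin m) (Fin n) ℝ → ℝ) := by
  unfold frobNorm
  fun_prop

theorem frobNorm_le_sum_abs (A : Matrix (Fin m) (Fin n) ℝ) :
    frobNorm A ≤ ∑ i, ∑ j, |A i j| := by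
  refine Real.sqrt_le_iff.2 ⟨by positivity, ?_⟩
  rw [← Fintype.sum_prod_type', ← Fintype.sum_prod_type']
  simp only [← sq_abs (A _ _)]
  exact Finset.sum_sq_le_sq_sum_of_nonneg fun p _ => abs_nonneg _

end FrobeniusInner

/-! ### Orthonormal columns, contractions and polar factors. -/

section Orthonormal

variable {m n k : ℕ}

/-- Pythagoras for the orthogonal projection `U * Uᵀ`. -/
theorem dotProduct_sub_mulVec_self {U : Matrix (Fin m) (Fin k) ℝ} (hU : Uᵀ * U = 1)
    (x : Fin m → ℝ) :
    (x - U *ᵥ (Uᵀ *ᵥ x)) ⬝ᵥ (x - U *ᵥ (Uᵀ *ᵥ x)) = x ⬝ᵥ x - (Uᵀ *ᵥ x) ⬝ᵥ (Uᵀ *ᵥ x) := by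
  have h1 : ∀ y : Fin k → ℝ, ∀ z : Fin m → ℝ, (U *ᵥ y) ⬝ᵥ z = y ⬝ᵥ (Uᵀ *ᵥ z) := fun y z => by
    rw [mulVec_transpose, dotProduct_comm, dotProduct_mulVec, dotProduct_comm]
  rw [sub_dotProduct, dotProduct_sub, dotProduct_sub, dotProduct_comm x (U *ᵥ _), h1, h1,
    mulVec_mulVec, hU, one_mulVec]
  ring

/-- Bessel's inequality for a matrix with orthonormal columns. -/
theorem dotProduct_transpose_mulVec_le {U : Matrix (Fin m) (Fin k) ℝ} (hU : Uᵀ * U = 1)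
    (x : Fin m → ℝ) : (Uᵀ *ᵥ x) ⬝ᵥ (Uᵀ *ᵥ x) ≤ x ⬝ᵥ x := by
  have h := dotProduct_sub_mulVec_self hU x
  have h0 : 0 ≤ (x - U *ᵥ (Uᵀ *ᵥ x)) ⬝ᵥ (x - U *ᵥ (Uᵀ *ᵥ x)) :=
    Finset.sum_nonneg fun i _ => mul_self_nonneg _
  linarith

theorem dotProduct_col_self {U : Matrix (Fin m) (Fin k) ℝ} (hU : Uᵀ * U = 1) (j : Fin k) :
    Uᵀ j ⬝ᵥ Uᵀ j = 1 := by
  simpa [mul_apply, dotProduct] using congrFun (congrFun hU j) j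

theorem dotProduct_le_half_add {l : ℕ} (x y : Fin l → ℝ) :
    x ⬝ᵥ y ≤ (x ⬝ᵥ x + y ⬝ᵥ y) / 2 := by
  have h : 0 ≤ (x - y) ⬝ᵥ (x - y) := Finset.sum_nonneg fun i _ => mul_self_nonneg _
  rw [sub_dotProduct, dotProduct_sub, dotProduct_sub, dotProduct_comm y x] at h
  linarith

/-- `X` has operator norm at most one, expressed by its bilinear form. -/
def IsContraction (X : Matrix (Fin m) (Fin n) ℝ) : Prop :=
  ∀ x y, x ⬝ᵥ (X *ᵥ y) ≤ (x ⬝ᵥ x + y ⬝ᵥ y) / 2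

theorem dotProduct_mul_transpose_mulVec (U : Matrix (Fin m) (Fin k) ℝ)
    (V : Matrix (Fin n) (Fin k) ℝ) (x : Fin m → ℝ) (y : Fin n → ℝ) :
    x ⬝ᵥ ((U * Vᵀ) *ᵥ y) = (Uᵀ *ᵥ x) ⬝ᵥ (Vᵀ *ᵥ y) := by
  rw [← mulVec_mulVec, dotProduct_mulVec, mulVec_transpose U]

theorem isContraction_mul_transpose {U : Matrix (Fin m) (Fin k) ℝ} {V : Matrix (Fin n) (Fin k) ℝ}
    (hU : Uᵀ * U = 1) (hV : Vᵀ * V = 1) : IsContraction (U * Vᵀ) := fun x y => by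
  rw [dotProduct_mul_transpose_mulVec]
  have := dotProduct_le_half_add (Uᵀ *ᵥ x) (Vᵀ *ᵥ y)
  have := dotProduct_transpose_mulVec_le hU x
  have := dotProduct_transpose_mulVec_le hV y
  linarith

/-- The two summands act between orthogonal pieces: `U * Vᵀ` between the column spaces of `V` and
`U`, the compression of `X` between their complements. By Pythagoras the two quadratic bounds add up
exactly. This is the dual certificate for the nuclear norm of a truncated decomposition. -/
theorem IsContraction.add_compression {U : Matrix (Fin m) (Fin k) ℝ}
    {V : Matrix (Fin n) (Fin k) ℝ} (hU : Uᵀ * U = 1) (hV : Vᵀ * V = 1)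
    {X : Matrix (Fin m) (Fin n) ℝ} (hX : IsContraction X) :
    IsContraction (U * Vᵀ + (1 - U * Uᵀ) * X * (1 - V * Vᵀ)) := fun x y => by
  have h1 := hX (x - U *ᵥ (Uᵀ *ᵥ x)) (y - V *ᵥ (Vᵀ *ᵥ y))
  rw [dotProduct_sub_mulVec_self hU, dotProduct_sub_mulVec_self hV] at h1
  have h2 := dotProduct_le_half_add (Uᵀ *ᵥ x) (Vᵀ *ᵥ y)
  have h3 : x ⬝ᵥ (((1 - U * Uᵀ) * X * (1 - V * Vᵀ)) *ᵥ y)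
      = (x - U *ᵥ (Uᵀ *ᵥ x)) ⬝ᵥ (X *ᵥ (y - V *ᵥ (Vᵀ *ᵥ y))) := by
    have hx : x ᵥ* (1 - U * Uᵀ) = x - U *ᵥ (Uᵀ *ᵥ x) := by
      rw [← mulVec_transpose]
      simp [sub_mulVec]
    rw [← mulVec_mulVec, ← mulVec_mulVec, dotProduct_mulVec, hx]
    simp [sub_mulVec]
  rw [add_mulVec, dotProduct_add, dotProduct_mul_transpose_mulVec, h3]
  linarith

theorem frobNorm_mul_transpose {U : Matrix (Fin m) (Fin k) ℝ} {V : Matrix (Fin n) (Fin k) ℝ}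
    (hU : Uᵀ * U = 1) (hV : Vᵀ * V = 1) : frobNorm (U * Vᵀ) = √k := by
  rw [eq_comm, Real.sqrt_eq_iff_eq_sq (by positivity) (frobNorm_nonneg _), frobNorm_sq,
    frobInner_eq_trace, transpose_mul, transpose_transpose, Matrix.mul_assoc,
    ← Matrix.mul_assoc Uᵀ, hU, Matrix.one_mul, trace_mul_comm, hV, trace_one, Fintype.card_fin]

theorem frobInner_mul_diagonal_mul (U : Matrix (Fin m) (Fin k) ℝ) (V : Matrix (Fin n) (Fin k) ℝ)
    (s : Fin k → ℝ) (X : Matrix (Fin m) (Fin n) ℝ) :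
    frobInner (U * diagonal s * Vᵀ) X = ∑ j, s j * (Uᵀ j ⬝ᵥ (X *ᵥ Vᵀ j)) := by
  rw [frobInner_eq_trace, transpose_mul, transpose_mul, transpose_transpose, diagonal_transpose,
    Matrix.mul_assoc, trace_mul_comm, Matrix.mul_assoc, Matrix.mul_assoc, trace]
  refine Finset.sum_congr rfl fun j _ => ?_
  rw [diag_apply, diagonal_mul]
  rfl

end Orthonormal

/-! ### Singular value decomposition, Ky Fan norms and nuclear norm. -/

section SingularValues

variable {m n k : ℕ}

theorem sv_nonneg (A : Matrix (Fin m) (Fin n) ℝ) (i : ℕ) : 0 ≤ sv A i :=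
  LinearMap.singularValues_nonneg _ _

theorem sv_antitone (A : Matrix (Fin m) (Fin n) ℝ) : Antitone (sv A) :=
  LinearMap.singularValues_antitone _

theorem sv_eq_zero_of_le (A : Matrix (Fin m) (Fin n) ℝ) {i : ℕ} (hi : m ≤ i) : sv A i = 0 := by
  refine (LinearMap.singularValues_eq_zero_iff_le_finrank_range _).2 (le_trans ?_ hi)
  simpa using Submodule.finrank_le (toEuclideanLin A).range

/-- The right singular vectors are an orthonormal eigenbasis of `AᵀA`. -/
theorem exists_orthonormalBasis_inner_toEuclideanLin (A : Matrix (Fin m) (Fin n) ℝ) :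
    ∃ c : OrthonormalBasis (Fin n) ℝ (EuclideanSpace ℝ (Fin n)), ∀ i j,
      inner ℝ (toEuclideanLin A (c i)) (toEuclideanLin A (c j)) =
        if i = j then sv A i ^ 2 else 0 := by
  set T := toEuclideanLin A
  have hn : Module.finrank ℝ (EuclideanSpace ℝ (Fin n)) = n := finrank_euclideanSpace_fin
  refine ⟨T.isSymmetric_adjoint_comp_self.eigenvectorBasis hn, fun i j => ?_⟩
  rw [← LinearMap.adjoint_inner_right, ← LinearMap.comp_apply,
    LinearMap.IsSymmetric.apply_eigenvectorBasis, inner_smul_right,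
    orthonormal_iff_ite.1 (OrthonormalBasis.orthonormal _), ← T.sq_singularValues_fin hn]
  split_ifs with h
  · simp [h, sv, T]
  · simp

/-- Left and right singular vectors, as orthonormal bases. -/
theorem exists_singular_orthonormalBasis (A : Matrix (Fin m) (Fin n) ℝ) :
    ∃ (a : OrthonormalBasis (Fin m) ℝ (EuclideanSpace ℝ (Fin m)))
      (c : OrthonormalBasis (Fin n) ℝ (EuclideanSpace ℝ (Fin n))),
      (∀ (i : Fin m) (j : Fin n), (i : ℕ) = j → toEuclideanLin A (c j) = sv A i • a i) ∧
      ∀ j : Fin n, m ≤ (j : ℕ) → toEuclideanLin A (c j) = 0 := by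
  obtain ⟨c, hc⟩ := exists_orthonormalBasis_inner_toEuclideanLin A
  have hzero : ∀ j : Fin n, sv A j = 0 → toEuclideanLin A (c j) = 0 := fun j hj => by
    rw [← inner_self_eq_zero (𝕜 := ℝ), hc, if_pos rfl, hj]
    simp
  -- Normalised images of the right singular vectors. They are orthonormal only where the singular
  -- value is nonzero, the set `s`; elsewhere their value is irrelevant, because the extension to a
  -- basis replaces them.
  let v : Fin m → EuclideanSpace ℝ (Fin m) := fun i =>
    if h : (i : ℕ) < n then (sv A i)⁻¹ • toEuclideanLin A (c ⟨i, h⟩) else 0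
  let s : Set (Fin m) := {i | (i : ℕ) < n ∧ sv A i ≠ 0}
  have hv : Orthonormal ℝ (s.domRestrict v) := by
    rw [orthonormal_iff_ite]
    rintro ⟨i, hi, hi'⟩ ⟨j, hj, hj'⟩
    change inner ℝ (v i) (v j) = _
    simp only [v, dif_pos hi, dif_pos hj, inner_smul_left, inner_smul_right,
      hc, Fin.mk.injEq, Subtype.mk.injEq, ← Fin.ext_iff]
    split_ifs with h
    · subst h
      simp only [conj_trivial]
      field_simp
    · simp
  obtain ⟨a, ha⟩ := hv.exists_orthonormalBasis_extension_of_card_eq (by simp)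
  refine ⟨a, c, fun i j hij => ?_, fun j hj => hzero j (sv_eq_zero_of_le A hj)⟩
  by_cases h0 : sv A i = 0
  · rw [h0, zero_smul, hzero j (by rwa [← hij])]
  · have hi : (i : ℕ) < n := hij ▸ j.2
    have hj : (⟨i, hi⟩ : Fin n) = j := Fin.ext hij
    rw [ha i ⟨hi, h0⟩]
    simp only [v, dif_pos hi, hj, smul_smul, mul_inv_cancel₀ h0, one_smul]

theorem transpose_mul_self_of_orthonormal {v : Fin k → EuclideanSpace ℝ (Fin m)}
    (hv : Orthonormal ℝ v) :
    (Matrix.of fun i j => v j i)ᵀ * (Matrix.of fun i j => v j i) = 1 := by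
  ext i j
  have := orthonormal_iff_ite.1 hv j i
  simp only [PiLp.inner_apply, RCLike.inner_apply, conj_trivial] at this
  simp [mul_apply, one_apply, this, eq_comm]

/-- Every matrix has a singular value decomposition. -/
theorem exists_svd (A : Matrix (Fin m) (Fin n) ℝ) :
    ∃ (P : Matrix (Fin m) (Fin (min m n)) ℝ) (Q : Matrix (Fin n) (Fin (min m n)) ℝ),
      IsTopSingularVectors A P Q ∧
        A = P * (diagonal fun i : Fin (min m n) => sv A i) * Qᵀ := by
  obtain ⟨a, c, h1, h2⟩ := exists_singular_orthonormalBasis A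
  let em : Fin (min m n) → Fin m := Fin.castLE (min_le_left m n)
  let en : Fin (min m n) → Fin n := Fin.castLE (min_le_right m n)
  have hen : Function.Injective en := Fin.castLE_injective _
  have hP := transpose_mul_self_of_orthonormal
    (a.orthonormal.comp em (Fin.castLE_injective (min_le_left m n)))
  have hQ := transpose_mul_self_of_orthonormal (c.orthonormal.comp en hen)
  set P : Matrix (Fin m) (Fin (min m n)) ℝ := Matrix.of fun i j => (a ∘ em) j i
  set Q : Matrix (Fin n) (Fin (min m n)) ℝ := Matrix.of fun i j => (c ∘ en) j i
  have hA : A = P * (diagonal fun i : Fin (min m n) => sv A i) * Qᵀ := by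
    ext i l
    have h3 := congrArg (fun x => toEuclideanLin A x i)
      (c.sum_repr' (EuclideanSpace.single l (1 : ℝ)))
    simp only [map_sum, map_smul] at h3
    have h4 : toEuclideanLin A (EuclideanSpace.single l (1 : ℝ)) i = A i l := by
      simp [toLpLin_apply]
    rw [h4] at h3
    rw [← h3, WithLp.ofLp_sum, Finset.sum_apply, mul_apply]
    symm
    -- In the expansion of `A e_l` along the basis `c`, the indices outside the range of `en` are at
    -- least `m`, where `A` kills the basis vector.
    refine Fintype.sum_of_injective en hen _ _ (fun j hj => ?_) fun j => ?_
    · rw [h2 j]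
      · simp
      · by_contra! hjm
        exact hj ⟨⟨j, lt_min hjm j.2⟩, rfl⟩
    · rw [h1 (em j) (en j) rfl, mul_diagonal]
      simp [P, Q, em, EuclideanSpace.inner_single_right]
      ring
  refine ⟨P, Q, ⟨hP, hQ, ?_, ?_⟩, hA⟩
  · conv_lhs => rw [hA]
    rw [Matrix.mul_assoc, hQ, Matrix.mul_one]
  · conv_lhs => rw [hA]
    rw [transpose_mul, transpose_mul, transpose_transpose, diagonal_transpose, Matrix.mul_assoc,
      Matrix.mul_assoc, hP, Matrix.mul_one]

theorem IsTopSingularVectors.frobInner_eq {A : Matrix (Fin m) (Fin n) ℝ}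
    {U : Matrix (Fin m) (Fin k) ℝ} {V : Matrix (Fin n) (Fin k) ℝ}
    (h : IsTopSingularVectors A U V) : frobInner A (U * Vᵀ) = kyFanNorm k A := by
  rw [frobInner_eq_trace, ← Matrix.mul_assoc, h.transpose_mul_left, Matrix.mul_assoc,
    trace_mul_comm, Matrix.mul_assoc, h.right_orthonormal, Matrix.mul_one, trace_diagonal,
    kyFanNorm, Finset.sum_range]

theorem IsTopSingularVectors.castLE {l : ℕ} (hl : l ≤ k) {A : Matrix (Fin m) (Fin n) ℝ}
    {U : Matrix (Fin m) (Fin k) ℝ} {V : Matrix (Fin n) (Fin k) ℝ}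
    (h : IsTopSingularVectors A U V) :
    IsTopSingularVectors A (U.submatrix id (Fin.castLE hl)) (V.submatrix id (Fin.castLE hl)) := by
  refine ⟨?_, ?_, ?_, ?_⟩ <;> ext i j
  · simpa [mul_apply, one_apply] using
      congrFun (congrFun h.left_orthonormal (Fin.castLE hl i)) (Fin.castLE hl j)
  · simpa [mul_apply, one_apply] using
      congrFun (congrFun h.right_orthonormal (Fin.castLE hl i)) (Fin.castLE hl j)
  · have := congrFun (congrFun h.mul_right i) (Fin.castLE hl j)
    rw [mul_diagonal] at this ⊢
    simpa [mul_apply] using this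
  · have := congrFun (congrFun h.transpose_mul_left i) (Fin.castLE hl j)
    rw [mul_diagonal] at this ⊢
    simpa [mul_apply] using this

theorem exists_isTopSingularVectors (hk : k ≤ min m n) (A : Matrix (Fin m) (Fin n) ℝ) :
    ∃ (U : Matrix (Fin m) (Fin k) ℝ) (V : Matrix (Fin n) (Fin k) ℝ),
      IsTopSingularVectors A U V := by
  obtain ⟨P, Q, h, -⟩ := exists_svd A
  exact ⟨_, _, h.castLE hk⟩

/-- A weighted sum of a nonnegative antitone sequence with weights in `[0, 1]` of total mass at
most `k` is at most the sum of the first `k` terms. -/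
theorem sum_mul_le_sum_range_of_antitone {s : ℕ → ℝ} (hs : Antitone s) (hs0 : ∀ i, 0 ≤ s i)
    {q : ℕ} (hk : k ≤ q) {w : ℕ → ℝ} (hw0 : ∀ j < q, 0 ≤ w j) (hw1 : ∀ j < q, w j ≤ 1)
    (hw : ∑ j ∈ Finset.range q, w j ≤ k) :
    ∑ j ∈ Finset.range q, s j * w j ≤ ∑ j ∈ Finset.range k, s j := by
  -- Subtracting the threshold `s k` makes the first `k` terms nonnegative, so weight at most one
  -- suffices, and the others nonpositive, so they can be dropped. The mass bound restores `s k`.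
  have h1 : ∑ j ∈ Finset.range q, (s j - s k) * w j ≤ ∑ j ∈ Finset.range k, (s j - s k) := by
    rw [← Finset.sum_range_add_sum_Ico _ hk]
    have h2 : ∑ j ∈ Finset.range k, (s j - s k) * w j ≤ ∑ j ∈ Finset.range k, (s j - s k) :=
      Finset.sum_le_sum fun j hj => by
        have hj := Finset.mem_range.1 hj
        exact mul_le_of_le_one_right (sub_nonneg.2 (hs hj.le)) (hw1 j (hj.trans_le hk))
    have h3 : ∑ j ∈ Finset.Ico k q, (s j - s k) * w j ≤ 0 :=
      Finset.sum_nonpos fun j hj => by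
        have hj := Finset.mem_Ico.1 hj
        exact mul_nonpos_of_nonpos_of_nonneg (sub_nonpos.2 (hs hj.1)) (hw0 j hj.2)
    linarith
  simp only [sub_mul, Finset.sum_sub_distrib, ← Finset.mul_sum, Finset.sum_const,
    Finset.card_range, nsmul_eq_mul] at h1
  nlinarith [mul_le_mul_of_nonneg_left hw (hs0 k)]

/-- Ky Fan's maximum principle. -/
theorem frobInner_mul_transpose_le_kyFanNorm (hk : k ≤ min m n) (A : Matrix (Fin m) (Fin n) ℝ)
    {U : Matrix (Fin m) (Fin k) ℝ} {V : Matrix (Fin n) (Fin k) ℝ}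
    (hU : Uᵀ * U = 1) (hV : Vᵀ * V = 1) : frobInner A (U * Vᵀ) ≤ kyFanNorm k A := by
  obtain ⟨P, Q, h, hA⟩ := exists_svd A
  have hA' : frobInner A (U * Vᵀ) =
      ∑ j : Fin (min m n), sv A j * (Pᵀ j ⬝ᵥ ((U * Vᵀ) *ᵥ Qᵀ j)) := by
    conv_lhs => rw [hA]
    exact frobInner_mul_diagonal_mul _ _ _ _
  -- Summing the squares of the entries of `Nᵀ * B` the other way round leaves `k` unit columns of
  -- `N`, each contributing at most one by Bessel.
  have sq_swap : ∀ {l : ℕ} {N : Matrix (Fin l) (Fin k) ℝ} {B : Matrix (Fin l) (Fin (min m n)) ℝ},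
      Nᵀ * N = 1 → Bᵀ * B = 1 → ∑ j, (Nᵀ *ᵥ Bᵀ j) ⬝ᵥ (Nᵀ *ᵥ Bᵀ j) ≤ k := by
    intro l N B hN hB
    have h1 : ∑ j, (Nᵀ *ᵥ Bᵀ j) ⬝ᵥ (Nᵀ *ᵥ Bᵀ j) = ∑ i, (Bᵀ *ᵥ Nᵀ i) ⬝ᵥ (Bᵀ *ᵥ Nᵀ i) := by
      simp only [dotProduct]
      rw [Finset.sum_comm]
      refine Finset.sum_congr rfl fun i _ => Finset.sum_congr rfl fun j _ => ?_
      simp only [mulVec, dotProduct_comm]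
    rw [h1]
    calc _ ≤ ∑ i : Fin k, (1 : ℝ) := Finset.sum_le_sum fun i _ =>
          (dotProduct_transpose_mulVec_le hB _).trans_eq (dotProduct_col_self hN i)
      _ = k := by simp
  let w : Fin (min m n) → ℝ := fun j =>
    ((Uᵀ *ᵥ Pᵀ j) ⬝ᵥ (Uᵀ *ᵥ Pᵀ j) + (Vᵀ *ᵥ Qᵀ j) ⬝ᵥ (Vᵀ *ᵥ Qᵀ j)) / 2
  let w' : ℕ → ℝ := fun j => if h : j < min m n then w ⟨j, h⟩ else 0
  have hw' : ∀ j : Fin (min m n), w' j = w j := fun j => dif_pos j.2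
  have hdot : ∀ {l : ℕ} (x : Fin l → ℝ), 0 ≤ x ⬝ᵥ x := fun x =>
    Finset.sum_nonneg fun i _ => mul_self_nonneg _
  calc frobInner A (U * Vᵀ) ≤ ∑ j : Fin (min m n), sv A j * w j := by
        rw [hA']
        refine Finset.sum_le_sum fun j _ => mul_le_mul_of_nonneg_left ?_ (sv_nonneg _ _)
        rw [dotProduct_mul_transpose_mulVec]
        exact dotProduct_le_half_add _ _
    _ = ∑ j ∈ Finset.range (min m n), sv A j * w' j := by
        simp only [Finset.sum_range, hw']
    _ ≤ kyFanNorm k A := by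
        refine sum_mul_le_sum_range_of_antitone (sv_antitone A) (sv_nonneg A) hk ?_ ?_ ?_
        · intro j hj
          rw [hw' ⟨j, hj⟩]
          have := hdot (Uᵀ *ᵥ Pᵀ ⟨j, hj⟩)
          have := hdot (Vᵀ *ᵥ Qᵀ ⟨j, hj⟩)
          simp only [w]
          linarith
        · intro j hj
          rw [hw' ⟨j, hj⟩]
          have h1 := dotProduct_transpose_mulVec_le hU (Pᵀ ⟨j, hj⟩)
          have h2 := dotProduct_transpose_mulVec_le hV (Qᵀ ⟨j, hj⟩)
          rw [dotProduct_col_self h.left_orthonormal] at h1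
          rw [dotProduct_col_self h.right_orthonormal] at h2
          simp only [w]
          linarith
        · have h1 := sq_swap hU h.left_orthonormal
          have h2 := sq_swap hV h.right_orthonormal
          simp only [Finset.sum_range, hw', w, ← Finset.sum_div, Finset.sum_add_distrib]
          linarith

/-- With `exists_isContraction_frobInner_eq`, this is the duality of nuclear and operator norms: a
contraction pairs each couple of unit singular vectors to at most one, and the polar factor attains
one throughout. -/
theorem frobInner_le_nuclearNorm (A : Matrix (Fin m) (Fin n) ℝ) {X : Matrix (Fin m) (Fin n) ℝ}
    (hX : IsContraction X) : frobInner A X ≤ nuclearNorm A := by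
  obtain ⟨P, Q, h, hA⟩ := exists_svd A
  have hA' : frobInner A X = ∑ j : Fin (min m n), sv A j * (Pᵀ j ⬝ᵥ (X *ᵥ Qᵀ j)) := by
    conv_lhs => rw [hA]
    exact frobInner_mul_diagonal_mul _ _ _ _
  rw [hA', nuclearNorm, Finset.sum_range]
  refine Finset.sum_le_sum fun j _ => mul_le_of_le_one_right (sv_nonneg _ _) ?_
  have := hX (Pᵀ j) (Qᵀ j)
  rw [dotProduct_col_self h.left_orthonormal, dotProduct_col_self h.right_orthonormal] at this
  linarith

theorem exists_isContraction_frobInner_eq (A : Matrix (Fin m) (Fin n) ℝ) :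
    ∃ X, IsContraction X ∧ frobInner A X = nuclearNorm A := by
  obtain ⟨P, Q, h, -⟩ := exists_svd A
  exact ⟨_, isContraction_mul_transpose h.left_orthonormal h.right_orthonormal, h.frobInner_eq⟩

/-- The nuclear norm of the tail of a singular value decomposition. -/
theorem IsRankTruncation.nuclearNorm_sub {A R : Matrix (Fin m) (Fin n) ℝ}
    (h : IsRankTruncation k A R) : nuclearNorm (A - R) = nuclearNorm A - kyFanNorm k A := by
  obtain ⟨U, V, hUV, hR⟩ := h
  apply le_antisymm
  -- A contraction optimal for the tail `A - R`, compressed to the complements and completed by `U *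
  -- Vᵀ`, tests `A` at the Ky Fan norm plus the nuclear norm of the tail.
  · obtain ⟨X, hX, hX'⟩ := exists_isContraction_frobInner_eq (A - R)
    have h1 := frobInner_le_nuclearNorm A
      (hX.add_compression hUV.left_orthonormal hUV.right_orthonormal)
    have hRt : Rᵀ = V * (diagonal fun i : Fin k => sv A i) * Uᵀ := by
      rw [hR, transpose_mul, transpose_mul, transpose_transpose, diagonal_transpose,
        Matrix.mul_assoc]
    have h2 : Aᵀ * (1 - U * Uᵀ) = (A - R)ᵀ := by
      rw [transpose_sub, Matrix.mul_sub, Matrix.mul_one, ← Matrix.mul_assoc,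
        hUV.transpose_mul_left, hRt]
    have h3 : V * Vᵀ * Aᵀ = Rᵀ := by
      rw [Matrix.mul_assoc, ← transpose_mul, hUV.mul_right, hRt, transpose_mul,
        diagonal_transpose, Matrix.mul_assoc]
    have h4 : V * Vᵀ * Rᵀ = Rᵀ := by
      rw [hRt, ← Matrix.mul_assoc, ← Matrix.mul_assoc, Matrix.mul_assoc V, hUV.right_orthonormal,
        Matrix.mul_one]
    have h5 : frobInner A ((1 - U * Uᵀ) * X * (1 - V * Vᵀ)) = frobInner (A - R) X := by
      rw [frobInner_eq_trace, frobInner_eq_trace, ← Matrix.mul_assoc, ← Matrix.mul_assoc, h2,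
        trace_mul_comm, ← Matrix.mul_assoc, Matrix.sub_mul, Matrix.one_mul, transpose_sub,
        Matrix.mul_sub, h3, h4, sub_self, sub_zero]
    rw [frobInner_add_right, hUV.frobInner_eq, h5, hX'] at h1
    linarith
  -- Triangle inequality: a contraction optimal for `A` gains at most the Ky Fan norm on `R`.
  · obtain ⟨X, hX, hX'⟩ := exists_isContraction_frobInner_eq A
    have h1 := frobInner_le_nuclearNorm (A - R) hX
    have h2 : frobInner R X ≤ kyFanNorm k A := by
      rw [hR, frobInner_mul_diagonal_mul, kyFanNorm, Finset.sum_range]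
      refine Finset.sum_le_sum fun j _ => mul_le_of_le_one_right (sv_nonneg _ _) ?_
      have := hX (Uᵀ j) (Vᵀ j)
      rw [dotProduct_col_self hUV.left_orthonormal,
        dotProduct_col_self hUV.right_orthonormal] at this
      linarith
    rw [frobInner_sub_left, hX'] at h1
    linarith

theorem kyFanNorm_nonneg (A : Matrix (Fin m) (Fin n) ℝ) : 0 ≤ kyFanNorm k A :=
  Finset.sum_nonneg fun i _ => sv_nonneg A i

/-- The polar factor of `A` is a competitor in the maximum principle for `B`, and its Frobenius norm
is `√k`. -/
theorem kyFanNorm_le_add (hk : k ≤ min m n) (A B : Matrix (Fin m) (Fin n) ℝ) :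
    kyFanNorm k A ≤ kyFanNorm k B + √k * frobNorm (A - B) := by
  obtain ⟨U, V, h⟩ := exists_isTopSingularVectors hk A
  have h1 := frobInner_mul_transpose_le_kyFanNorm hk B h.left_orthonormal h.right_orthonormal
  have h2 := frobInner_le (A - B) (U * Vᵀ)
  rw [frobNorm_mul_transpose h.left_orthonormal h.right_orthonormal, frobInner_sub_left,
    h.frobInner_eq] at h2
  linarith

theorem continuous_kyFanNorm (hk : k ≤ min m n) :
    Continuous (kyFanNorm k : Matrix (Fin m) (Fin n) ℝ → ℝ) := by
  refine continuous_iff_continuousAt.2 fun A => ?_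
  rw [ContinuousAt, tendsto_iff_dist_tendsto_zero]
  have h : Continuous fun B : Matrix (Fin m) (Fin n) ℝ => √k * frobNorm (B - A) :=
    continuous_const.mul (continuous_frobNorm.comp (continuous_id.sub continuous_const))
  have h0 := h.tendsto A
  simp only [sub_self] at h0
  rw [show frobNorm (0 : Matrix (Fin m) (Fin n) ℝ) = 0 by simp [frobNorm], mul_zero] at h0
  refine squeeze_zero (fun _ => dist_nonneg) (fun B => ?_) h0
  rw [Real.dist_eq, abs_le]
  have h1 := kyFanNorm_le_add hk A B
  have h2 := kyFanNorm_le_add hk B A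
  rw [frobNorm_sub_comm] at h1
  constructor <;> linarith

theorem kyFanNorm_le_frobNorm (hk : k ≤ min m n) (A : Matrix (Fin m) (Fin n) ℝ) :
    kyFanNorm k A ≤ √k * frobNorm A := by
  obtain ⟨U, V, h⟩ := exists_isTopSingularVectors hk A
  rw [← h.frobInner_eq, mul_comm, ← frobNorm_mul_transpose h.left_orthonormal h.right_orthonormal]
  exact frobInner_le _ _

end SingularValues

/-! ### Smoothness, the descent lemma and one-step progress. -/

section Smooth

variable {m n k : ℕ} {f : Matrix (Fin m) (Fin n) ℝ → ℝ} {L : ℝ}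

theorem fderiv_apply_eq_frobInner (f : Matrix (Fin m) (Fin n) ℝ → ℝ)
    (W D : Matrix (Fin m) (Fin n) ℝ) : fderiv ℝ f W D = frobInner (grad f W) D := by
  conv_lhs => rw [matrix_eq_sum_single D]
  simp only [map_sum, frobInner, grad, of_apply]
  refine Finset.sum_congr rfl fun i _ => Finset.sum_congr rfl fun j _ => ?_
  rw [← mul_one (D i j), ← smul_eq_mul (D i j), ← smul_single, map_smul, smul_eq_mul, mul_comm,
    smul_eq_mul, mul_one]

theorem hasDerivAt_comp_add_smul (hf : Differentiable ℝ f) (W D : Matrix (Fin m) (Fin n) ℝ)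
    (s : ℝ) : HasDerivAt (fun s : ℝ => f (W + s • D)) (frobInner (grad f (W + s • D)) D) s := by
  rw [← fderiv_apply_eq_frobInner]
  -- The derivative depends only on the topology, so a local choice of norm inducing it is harmless.
  let := Matrix.normedAddCommGroup (m := Fin m) (n := Fin n) (α := ℝ)
  let := Matrix.normedSpace (R := ℝ) (m := Fin m) (n := Fin n) (α := ℝ)
  have h1 : HasDerivAt (fun s : ℝ => W + s • D) D s := by
    have h := ((hasDerivAt_id s).smul_const D).const_add W
    rw [one_smul] at h
    exact h
  exact (hf (W + s • D)).hasFDerivAt.comp_hasDerivAt s h1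

theorem IsLSmooth.nonneg (hf : IsLSmooth f L) (hm : 0 < m) (hn : 0 < n) : 0 ≤ L := by
  have h := hf.frobNorm_grad_sub_le (single ⟨0, hm⟩ ⟨0, hn⟩ 1) 0
  have h1 : 0 < frobNorm (single ⟨0, hm⟩ ⟨0, hn⟩ 1 - 0 : Matrix (Fin m) (Fin n) ℝ) := by
    refine lt_of_lt_of_le one_pos ?_
    rw [sub_zero]
    simpa using abs_apply_le_frobNorm
      (single ⟨0, hm⟩ ⟨0, hn⟩ 1 : Matrix (Fin m) (Fin n) ℝ) ⟨0, hm⟩ ⟨0, hn⟩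
  exact nonneg_of_mul_nonneg_left ((frobNorm_nonneg _).trans h) h1

/-- The descent lemma. -/
theorem IsLSmooth.le_add (hf : IsLSmooth f L) (W D : Matrix (Fin m) (Fin n) ℝ) :
    f (W + D) ≤ f W + frobInner (grad f W) D + L / 2 * frobNorm D ^ 2 := by
  -- The gap between `f` and its quadratic upper model along the segment; smoothness makes its
  -- derivative nonpositive.
  let φ : ℝ → ℝ := fun s =>
    f (W + s • D) - s * frobInner (grad f W) D - s ^ 2 * (L / 2 * frobNorm D ^ 2)
  have hφ : ∀ s, HasDerivAt φ (frobInner (grad f (W + s • D)) D - frobInner (grad f W) D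
      - 2 * s * (L / 2 * frobNorm D ^ 2)) s := fun s => by
    have h1 := (hasDerivAt_id s).mul_const (frobInner (grad f W) D)
    have h2 := (hasDerivAt_pow 2 s).mul_const (L / 2 * frobNorm D ^ 2)
    have h3 := ((hasDerivAt_comp_add_smul hf.differentiable W D s).sub h1).sub h2
    convert! h3 using 1
    simp
  have hanti : AntitoneOn φ (Set.Icc 0 1) := by
    refine antitoneOn_of_deriv_nonpos (convex_Icc 0 1)
      (fun s _ => (hφ s).continuousAt.continuousWithinAt)
      (fun s _ => (hφ s).differentiableAt.differentiableWithinAt) fun s hs => ?_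
    rw [interior_Icc] at hs
    rw [(hφ s).deriv, ← frobInner_sub_left]
    have h1 := frobInner_le (grad f (W + s • D) - grad f W) D
    have h2 := hf.frobNorm_grad_sub_le (W + s • D) W
    rw [add_sub_cancel_left, frobNorm_smul, abs_of_pos hs.1] at h2
    have h3 := mul_le_mul_of_nonneg_right h2 (frobNorm_nonneg D)
    nlinarith
  have h := hanti (Set.left_mem_Icc.2 zero_le_one) (Set.right_mem_Icc.2 zero_le_one) zero_le_one
  simp only [φ, one_smul, zero_smul, add_zero] at h
  linarith

theorem grad_neg (f : Matrix (Fin m) (Fin n) ℝ → ℝ) (W : Matrix (Fin m) (Fin n) ℝ) :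
    grad (fun W => -f W) W = -grad f W := by
  have h : fderiv ℝ (fun W => -f W) W = -fderiv ℝ f W := by
    let := Matrix.normedAddCommGroup (m := Fin m) (n := Fin n) (α := ℝ)
    let := Matrix.normedSpace (R := ℝ) (m := Fin m) (n := Fin n) (α := ℝ)
    exact fderiv_fun_neg
  ext i j
  rw [neg_apply, grad, grad, of_apply, of_apply, h, _root_.neg_apply]

theorem IsLSmooth.neg (hf : IsLSmooth f L) : IsLSmooth (fun W => -f W) L where
  differentiable := by
    let := Matrix.normedAddCommGroup (m := Fin m) (n := Fin n) (α := ℝ)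
    let := Matrix.normedSpace (R := ℝ) (m := Fin m) (n := Fin n) (α := ℝ)
    exact Differentiable.fun_neg hf.differentiable
  frobNorm_grad_sub_le W W' := by
    rw [grad_neg, grad_neg, neg_sub_neg, frobNorm_sub_comm]
    exact hf.frobNorm_grad_sub_le W W'

theorem IsLSmooth.abs_sub_le (hf : IsLSmooth f L) (W D : Matrix (Fin m) (Fin n) ℝ) :
    |f (W + D) - f W| ≤ frobNorm (grad f W) * frobNorm D + L / 2 * frobNorm D ^ 2 := by
  have h1 := hf.le_add W D
  have h2 := hf.neg.le_add W D
  have h3 := abs_le.1 (abs_frobInner_le (grad f W) D)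
  rw [grad_neg, ← neg_one_smul ℝ (grad f W), frobInner_smul_left] at h2
  exact abs_le.2 ⟨by linarith, by linarith⟩

theorem IsLSmooth.continuous (hf : IsLSmooth f L) : Continuous f := by
  let := Matrix.normedAddCommGroup (m := Fin m) (n := Fin n) (α := ℝ)
  let := Matrix.normedSpace (R := ℝ) (m := Fin m) (n := Fin n) (α := ℝ)
  exact Differentiable.continuous hf.differentiable

theorem IsLSmooth.continuous_grad (hf : IsLSmooth f L) : Continuous (grad f) := by
  refine continuous_matrix fun i j => continuous_iff_continuousAt.2 fun A => ?_
  rw [ContinuousAt, tendsto_iff_dist_tendsto_zero]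
  have h : Continuous fun B : Matrix (Fin m) (Fin n) ℝ => L * frobNorm (B - A) :=
    continuous_const.mul (continuous_frobNorm.comp (continuous_id.sub continuous_const))
  have h0 := h.tendsto A
  simp only [sub_self] at h0
  rw [show frobNorm (0 : Matrix (Fin m) (Fin n) ℝ) = 0 by simp [frobNorm], mul_zero] at h0
  refine squeeze_zero (fun _ => dist_nonneg) (fun B => ?_) h0
  exact (abs_apply_le_frobNorm (grad f B - grad f A) i j).trans (hf.frobNorm_grad_sub_le B A)

/-- The progress of one step along the polar factor of an approximate gradient `M`. -/
theorem IsLSmooth.kyFanNorm_grad_le (hf : IsLSmooth f L) (hk : k ≤ min m n) {γ : ℝ} (hγ : 0 < γ)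
    {W M : Matrix (Fin m) (Fin n) ℝ} {U : Matrix (Fin m) (Fin k) ℝ}
    {V : Matrix (Fin n) (Fin k) ℝ} (h : IsTopSingularVectors M U V) :
    kyFanNorm k (grad f W) ≤ (f W - f (W - γ • (U * Vᵀ))) / γ + L * k * γ / 2
      + 2 * √k * frobNorm (M - grad f W) := by
  have hUV := frobNorm_mul_transpose h.left_orthonormal h.right_orthonormal
  have h1 := hf.le_add W ((-γ) • (U * Vᵀ))
  rw [frobInner_smul_right, frobNorm_smul, hUV, abs_neg, abs_of_pos hγ, mul_pow,
    Real.sq_sqrt k.cast_nonneg, neg_smul, ← sub_eq_add_neg] at h1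
  have h2 := frobInner_le (M - grad f W) (U * Vᵀ)
  rw [frobInner_sub_left, h.frobInner_eq, hUV] at h2
  have h3 := kyFanNorm_le_add hk (grad f W) M
  rw [frobNorm_sub_comm] at h3
  have h4 : frobInner (grad f W) (U * Vᵀ) ≤
      (f W - f (W - γ • (U * Vᵀ))) / γ + L * k * γ / 2 := by
    rw [← sub_le_iff_le_add, le_div_iff₀ hγ]
    linarith
  linarith

end Smooth

/-! ### Momentum as a linear filter, and its lag. -/

section Momentum

variable {m n k : ℕ} {β : ℝ}

theorem momentum_sub (β : ℝ) (G H : ℕ → Matrix (Fin m) (Fin n) ℝ) (t : ℕ) :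
    momentum β (fun s => G s - H s) t = momentum β G t - momentum β H t := by
  induction t with
  | zero => rfl
  | succ t ih =>
    rw [momentum, momentum, momentum, ih, smul_sub, smul_sub]
    abel

/-- The momentum average of a slowly varying sequence stays close to the sequence. -/
theorem frobNorm_momentum_sub_le (hβ₀ : 0 ≤ β) (hβ₁ : β < 1)
    {H : ℕ → Matrix (Fin m) (Fin n) ℝ} {c : ℝ} (hH : ∀ t, frobNorm (H t - H (t + 1)) ≤ c) (t : ℕ) :
    frobNorm (momentum β H t - H t) ≤ β * c / (1 - β) := by
  have hc : 0 ≤ c := (frobNorm_nonneg _).trans (hH 0)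
  have h1 : 0 < 1 - β := sub_pos.2 hβ₁
  induction t with
  | zero =>
    rw [momentum, sub_self, show frobNorm (0 : Matrix (Fin m) (Fin n) ℝ) = 0 by simp [frobNorm]]
    positivity
  | succ t ih =>
    -- The lag obeys `e ↦ β (e + c)`, whose fixed point is `β * c / (1 - β)`.
    have h2 : momentum β H (t + 1) - H (t + 1) =
        β • ((momentum β H t - H t) + (H t - H (t + 1))) := by
      rw [momentum, sub_add_sub_cancel, smul_sub, sub_smul, one_smul]
      abel
    rw [h2, frobNorm_smul, abs_of_nonneg hβ₀]
    calc β * frobNorm ((momentum β H t - H t) + (H t - H (t + 1)))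
        ≤ β * (β * c / (1 - β) + c) := by
          gcongr
          exact (frobNorm_add_le _ _).trans (add_le_add ih (hH t))
      _ = β * c / (1 - β) := by
          field_simp
          ring

end Momentum

/-! ### Moments of the averaged noise. -/

section MomentumNoise

variable {m n : ℕ} {Ω : Type*} {mΩ : MeasurableSpace Ω} {μ : Measure Ω} {β : ℝ}

theorem measurable_comp_of_continuous {m' : MeasurableSpace Ω}
    {φ : Matrix (Fin m) (Fin n) ℝ → ℝ} (hφ : Continuous φ)
    {Y : Ω → Matrix (Fin m) (Fin n) ℝ} (hY : ∀ i j, Measurable[m'] fun ω => Y ω i j) :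
    Measurable[m'] fun ω => φ (Y ω) := by
  have h0 : Continuous fun B : Fin m → Fin n → ℝ => φ (Matrix.of B) := hφ
  have h1 := h0.measurable
  have h2 : Measurable[m'] fun ω => (fun i j => Y ω i j : Fin m → Fin n → ℝ) :=
    measurable_pi_lambda _ fun i => measurable_pi_lambda _ fun j => hY i j
  exact h1.comp h2

theorem memLp_frobNorm {Y : Ω → Matrix (Fin m) (Fin n) ℝ}
    (hY : ∀ i j, Measurable fun ω => Y ω i j) (hY2 : ∀ i j, MemLp (fun ω => Y ω i j) 2 μ) :
    MemLp (fun ω => frobNorm (Y ω)) 2 μ := by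
  have h : MemLp (fun ω => ∑ i, ∑ j, |Y ω i j|) 2 μ :=
    memLp_finsetSum _ fun i _ => memLp_finsetSum _ fun j _ => (hY2 i j).abs
  refine h.mono (measurable_comp_of_continuous continuous_frobNorm hY).aestronglyMeasurable
    (.of_forall fun ω => ?_)
  rw [Real.norm_of_nonneg (frobNorm_nonneg _), Real.norm_of_nonneg (by positivity)]
  exact frobNorm_le_sum_abs _

theorem integral_frobNorm_sq {Y : Ω → Matrix (Fin m) (Fin n) ℝ}
    (hY2 : ∀ i j, MemLp (fun ω => Y ω i j) 2 μ) :
    ∫ ω, frobNorm (Y ω) ^ 2 ∂μ = ∑ i, ∑ j, ∫ ω, Y ω i j ^ 2 ∂μ := by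
  simp only [frobNorm_sq, frobInner, ← sq]
  rw [integral_finsetSum _ fun i _ => integrable_finsetSum _ fun j _ => (hY2 i j).integrable_sq]
  refine Finset.sum_congr rfl fun i _ => ?_
  rw [integral_finsetSum _ fun j _ => (hY2 i j).integrable_sq]

theorem measurable_momentum {ℱ : Filtration ℕ mΩ} {X : ℕ → Ω → Matrix (Fin m) (Fin n) ℝ}
    (hX : ∀ t i j, Measurable[ℱ (t + 1)] fun ω => X t ω i j) (t : ℕ) (i : Fin m) (j : Fin n) :
    Measurable[ℱ (t + 1)] fun ω => momentum β (fun s => X s ω) t i j := by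
  induction t with
  | zero => exact hX 0 i j
  | succ t ih =>
    exact ((ih.mono (ℱ.mono (Nat.le_succ _)) le_rfl).const_mul β).add
      ((hX (t + 1) i j).const_mul (1 - β))

theorem memLp_momentum {X : ℕ → Ω → Matrix (Fin m) (Fin n) ℝ}
    (hX : ∀ t i j, MemLp (fun ω => X t ω i j) 2 μ) (t : ℕ) (i : Fin m) (j : Fin n) :
    MemLp (fun ω => momentum β (fun s => X s ω) t i j) 2 μ := by
  induction t with
  | zero => exact hX 0 i j
  | succ t ih => exact (ih.const_mul β).add ((hX (t + 1) i j).const_mul (1 - β))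

/-- The product of an adapted square integrable variable with a martingale difference has mean
zero. -/
theorem integral_mul_eq_zero_of_condExp_eq_zero {m' : MeasurableSpace Ω} (hm : m' ≤ mΩ)
    [IsFiniteMeasure μ] {Y X : Ω → ℝ} (hY : Measurable[m'] Y) (hY2 : MemLp Y 2 μ)
    (hX2 : MemLp X 2 μ) (hX : μ[X | m'] =ᵐ[μ] 0) : ∫ ω, Y ω * X ω ∂μ = 0 := by
  have h1 := condExp_mul_of_stronglyMeasurable_left (μ := μ) hY.stronglyMeasurable
    (hY2.integrable_mul hX2) (hX2.integrable one_le_two)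
  have h2 : μ[Y * X | m'] =ᵐ[μ] 0 := by
    filter_upwards [h1, hX] with ω h h'
    rw [h, Pi.mul_apply, h']
    simp
  have h3 := integral_condExp (μ := μ) (f := Y * X) hm
  rw [integral_congr_ae h2] at h3
  simpa using h3.symm

/-- The cross term vanishes: the average up to time `t` is `ℱ (t + 1)`-measurable, and `X (t + 1)`
has conditional mean zero given `ℱ (t + 1)`. -/
theorem integral_frobNorm_momentum_succ_sq [IsFiniteMeasure μ] {ℱ : Filtration ℕ mΩ}
    {X : ℕ → Ω → Matrix (Fin m) (Fin n) ℝ}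
    (hX : ∀ t i j, Measurable[ℱ (t + 1)] fun ω => X t ω i j)
    (hX2 : ∀ t i j, MemLp (fun ω => X t ω i j) 2 μ)
    (hX0 : ∀ t i j, μ[fun ω => X t ω i j | ℱ t] =ᵐ[μ] 0) (t : ℕ) :
    ∫ ω, frobNorm (momentum β (fun s => X s ω) (t + 1)) ^ 2 ∂μ =
      β ^ 2 * ∫ ω, frobNorm (momentum β (fun s => X s ω) t) ^ 2 ∂μ +
        (1 - β) ^ 2 * ∫ ω, frobNorm (X (t + 1) ω) ^ 2 ∂μ := by
  rw [integral_frobNorm_sq (memLp_momentum hX2 (t + 1)), integral_frobNorm_sq (memLp_momentum hX2 t),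
    integral_frobNorm_sq (hX2 (t + 1))]
  simp only [Finset.mul_sum, ← Finset.sum_add_distrib]
  refine Finset.sum_congr rfl fun i _ => Finset.sum_congr rfl fun j _ => ?_
  have hN := memLp_momentum (β := β) hX2 t i j
  have hmul := integral_mul_eq_zero_of_condExp_eq_zero (ℱ.le (t + 1))
    (measurable_momentum (β := β) hX t i j) hN (hX2 (t + 1) i j) (hX0 (t + 1) i j)
  have hexp : ∀ ω, momentum β (fun s => X s ω) (t + 1) i j ^ 2 =
      β ^ 2 * momentum β (fun s => X s ω) t i j ^ 2 + (1 - β) ^ 2 * X (t + 1) ω i j ^ 2 +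
        2 * β * (1 - β) * (momentum β (fun s => X s ω) t i j * X (t + 1) ω i j) := fun ω => by
    simp only [momentum, Matrix.add_apply, Matrix.smul_apply, smul_eq_mul]
    ring
  simp only [hexp]
  have h1 := hN.integrable_sq.const_mul (β ^ 2)
  have h2 := (hX2 (t + 1) i j).integrable_sq.const_mul ((1 - β) ^ 2)
  have h3 := (hN.integrable_mul (hX2 (t + 1) i j)).const_mul (2 * β * (1 - β))
  simp only [Pi.mul_apply] at h3
  have h12 : Integrable (fun ω => β ^ 2 * momentum β (fun s => X s ω) t i j ^ 2 +
      (1 - β) ^ 2 * X (t + 1) ω i j ^ 2) μ := h1.add h2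
  rw [integral_add h12 h3, integral_add h1 h2, integral_const_mul, integral_const_mul,
    integral_const_mul, hmul, mul_zero, add_zero]

/-- The recursion `a ↦ β² a + (1 - β)² v` has fixed point `v (1 - β) / (1 + β)`. It starts at `v`,
so the initial excess is `2 β v / (1 + β)`, and this decays by `β²` per step. -/
theorem integral_frobNorm_momentum_sq_le [IsFiniteMeasure μ] {ℱ : Filtration ℕ mΩ}
    (hβ₀ : 0 ≤ β) {v : ℝ} {X : ℕ → Ω → Matrix (Fin m) (Fin n) ℝ}
    (hX : ∀ t i j, Measurable[ℱ (t + 1)] fun ω => X t ω i j)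
    (hX2 : ∀ t i j, MemLp (fun ω => X t ω i j) 2 μ)
    (hX0 : ∀ t i j, μ[fun ω => X t ω i j | ℱ t] =ᵐ[μ] 0)
    (hv : ∀ t, ∫ ω, frobNorm (X t ω) ^ 2 ∂μ ≤ v) (t : ℕ) :
    ∫ ω, frobNorm (momentum β (fun s => X s ω) t) ^ 2 ∂μ ≤
      v * ((1 - β) / (1 + β) + 2 * β / (1 + β) * (β ^ t) ^ 2) := by
  induction t with
  | zero =>
    refine (hv 0).trans_eq ?_
    field_simp
    ring
  | succ t ih =>
    rw [integral_frobNorm_momentum_succ_sq hX hX2 hX0]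
    calc _ ≤ β ^ 2 * (v * ((1 - β) / (1 + β) + 2 * β / (1 + β) * (β ^ t) ^ 2)) +
          (1 - β) ^ 2 * v := by
          gcongr
          exact hv (t + 1)
      _ = _ := by
        rw [pow_succ]
        field_simp
        ring

theorem integral_le_sqrt_integral_sq [IsProbabilityMeasure μ] {Y : Ω → ℝ} (hY : MemLp Y 2 μ) :
    ∫ ω, Y ω ∂μ ≤ √(∫ ω, Y ω ^ 2 ∂μ) := by
  refine Real.le_sqrt_of_sq_le ?_
  have h1 := ProbabilityTheory.variance_eq_sub hY
  have h2 := ProbabilityTheory.variance_nonneg Y μ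
  rw [h1] at h2
  simpa using h2

theorem integral_frobNorm_momentum_le [IsProbabilityMeasure μ] {ℱ : Filtration ℕ mΩ}
    (hβ₀ : 0 ≤ β) (hβ₁ : β < 1) {v : ℝ} (hv0 : 0 ≤ v) {X : ℕ → Ω → Matrix (Fin m) (Fin n) ℝ}
    (hX : ∀ t i j, Measurable[ℱ (t + 1)] fun ω => X t ω i j)
    (hX2 : ∀ t i j, MemLp (fun ω => X t ω i j) 2 μ)
    (hX0 : ∀ t i j, μ[fun ω => X t ω i j | ℱ t] =ᵐ[μ] 0)
    (hv : ∀ t, ∫ ω, frobNorm (X t ω) ^ 2 ∂μ ≤ v) (t : ℕ) :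
    ∫ ω, frobNorm (momentum β (fun s => X s ω) t) ∂μ ≤
      √v * (√((1 - β) / (1 + β)) + β * β ^ t) := by
  have hmeas : ∀ i j, Measurable fun ω => momentum β (fun s => X s ω) t i j := fun i j =>
    (measurable_momentum hX t i j).mono (ℱ.le _) le_rfl
  refine (integral_le_sqrt_integral_sq (memLp_frobNorm hmeas (memLp_momentum hX2 t))).trans ?_
  refine (Real.sqrt_le_sqrt (integral_frobNorm_momentum_sq_le hβ₀ hX hX2 hX0 hv t)).trans ?_
  rw [Real.sqrt_mul hv0]
  refine mul_le_mul_of_nonneg_left ?_ (Real.sqrt_nonneg v)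
  have h1 : 0 < 1 + β := by linarith
  have hr0 : 0 ≤ (1 - β) / (1 + β) := div_nonneg (by linarith) h1.le
  set r := (1 - β) / (1 + β) with hr
  have hr1 : 2 * β / (1 + β) = 1 - r := by
    rw [hr]
    field_simp
    ring
  have hle1 : √r ≤ 1 := Real.sqrt_le_one.2 <| by
    rw [hr, div_le_one h1]
    linarith
  -- After squaring, this is `1 - β² ≤ 1`.
  have hβr : 1 - β ≤ √r := by
    refine Real.le_sqrt_of_sq_le ?_
    rw [hr, le_div_iff₀ h1]
    nlinarith [mul_nonneg (sq_nonneg β) (sub_nonneg.2 hβ₁.le)]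
  have hx0 : 0 ≤ β ^ t := pow_nonneg hβ₀ t
  have hx1 : β ^ t ≤ 1 := pow_le_one₀ hβ₀ hβ₁.le
  have hs := Real.sq_sqrt hr0
  have hs0 := Real.sqrt_nonneg r
  -- Subadditivity of the root would give the larger coefficient `√(1 - r)`. With `x = β ^ t`, the
  -- square of the right side exceeds `r + (1 - r) x²` by `2 √r (1 - √r) x (1 - x)`.
  calc √(r + 2 * β / (1 + β) * (β ^ t) ^ 2) ≤ √r + (1 - √r) * β ^ t := by
        refine Real.sqrt_le_iff.2 ⟨by nlinarith, ?_⟩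
        rw [hr1]
        have h2 : 0 ≤ √r * (1 - √r) * (β ^ t * (1 - β ^ t)) :=
          mul_nonneg (mul_nonneg hs0 (by linarith)) (mul_nonneg hx0 (by linarith))
        nlinarith
    _ ≤ √r + β * β ^ t := by
        gcongr
        linarith

theorem sum_integral_frobNorm_momentum_le [IsProbabilityMeasure μ] {ℱ : Filtration ℕ mΩ}
    (hβ₀ : 0 ≤ β) (hβ₁ : β < 1) {v : ℝ} (hv0 : 0 ≤ v) {X : ℕ → Ω → Matrix (Fin m) (Fin n) ℝ}
    (hX : ∀ t i j, Measurable[ℱ (t + 1)] fun ω => X t ω i j)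
    (hX2 : ∀ t i j, MemLp (fun ω => X t ω i j) 2 μ)
    (hX0 : ∀ t i j, μ[fun ω => X t ω i j | ℱ t] =ᵐ[μ] 0)
    (hv : ∀ t, ∫ ω, frobNorm (X t ω) ^ 2 ∂μ ≤ v) (T : ℕ) :
    ∑ t ∈ Finset.range T, ∫ ω, frobNorm (momentum β (fun s => X s ω) t) ∂μ ≤
      √v * (T * √((1 - β) / (1 + β)) + β / (1 - β)) := by
  refine (Finset.sum_le_sum fun t _ =>
    integral_frobNorm_momentum_le hβ₀ hβ₁ hv0 hX hX2 hX0 hv t).trans ?_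
  rw [← Finset.mul_sum, Finset.sum_add_distrib, ← Finset.mul_sum, Finset.sum_const,
    Finset.card_range, nsmul_eq_mul, div_eq_mul_inv β, ← tsum_geometric_of_lt_one hβ₀ hβ₁]
  gcongr
  exact (summable_geometric_of_lt_one hβ₀ hβ₁).sum_le_tsum _ fun t _ => pow_nonneg hβ₀ t

end MomentumNoise

/-! ### Measurability and integrability along the iterates. -/

section StochasticGradient

variable {m n : ℕ} {Ω : Type*} {mΩ : MeasurableSpace Ω} {μ : Measure Ω}
  {ℱ : Filtration ℕ mΩ} {f : Matrix (Fin m) (Fin n) ℝ → ℝ}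
  {W G : ℕ → Ω → Matrix (Fin m) (Fin n) ℝ} {v L : ℝ}

/-- Unbiasedness makes the gradient a version of a conditional expectation, hence integrable. -/
theorem IsStochasticGradient.integrable_grad (h : IsStochasticGradient μ ℱ f W G v) (t : ℕ)
    (i : Fin m) (j : Fin n) : Integrable (fun ω => grad f (W t ω) i j) μ :=
  integrable_condExp.congr (h.unbiased t i j)

theorem IsStochasticGradient.measurable_grad (h : IsStochasticGradient μ ℱ f W G v)
    (hf : IsLSmooth f L) (t : ℕ) (i : Fin m) (j : Fin n) :
    Measurable[ℱ t] fun ω => grad f (W t ω) i j :=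
  measurable_comp_of_continuous (φ := fun A => grad f A i j)
    (hf.continuous_grad.matrix_elem i j) (h.iterate_measurable t)

theorem IsStochasticGradient.measurable_sub (h : IsStochasticGradient μ ℱ f W G v)
    (hf : IsLSmooth f L) (t : ℕ) (i : Fin m) (j : Fin n) :
    Measurable[ℱ (t + 1)] fun ω => (G t ω - grad f (W t ω)) i j :=
  (h.estimator_measurable t i j).sub
    ((h.measurable_grad hf t i j).mono (ℱ.mono (Nat.le_succ t)) le_rfl)

theorem IsStochasticGradient.memLp_sub (h : IsStochasticGradient μ ℱ f W G v)
    (hf : IsLSmooth f L) (t : ℕ) (i : Fin m) (j : Fin n) :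
    MemLp (fun ω => (G t ω - grad f (W t ω)) i j) 2 μ := by
  have hm := ((h.measurable_sub hf t i j).mono (ℱ.le _) le_rfl).aestronglyMeasurable (μ := μ)
  refine (memLp_two_iff_integrable_sq hm).2 ((h.integrable_sq t).mono (hm.pow 2)
    (.of_forall fun ω => ?_))
  rw [Real.norm_of_nonneg (sq_nonneg _), Real.norm_of_nonneg (sq_nonneg _)]
  exact sq_le_sq' (neg_le_of_abs_le (abs_apply_le_frobNorm _ i j))
    (le_of_abs_le (abs_apply_le_frobNorm _ i j))

theorem IsStochasticGradient.condExp_sub [IsFiniteMeasure μ]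
    (h : IsStochasticGradient μ ℱ f W G v) (hf : IsLSmooth f L) (t : ℕ) (i : Fin m) (j : Fin n) :
    μ[fun ω => (G t ω - grad f (W t ω)) i j | ℱ t] =ᵐ[μ] 0 := by
  have h1 := MeasureTheory.condExp_sub (h.integrable t i j) (h.integrable_grad t i j) (ℱ t)
  rw [condExp_of_stronglyMeasurable (ℱ.le t) (h.measurable_grad hf t i j).stronglyMeasurable
    (h.integrable_grad t i j)] at h1
  refine h1.trans ?_
  filter_upwards [h.unbiased t i j] with ω hω
  simp [hω]

theorem IsStochasticGradient.integrable_frobNorm_grad (h : IsStochasticGradient μ ℱ f W G v)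
    (hf : IsLSmooth f L) (t : ℕ) : Integrable (fun ω => frobNorm (grad f (W t ω))) μ := by
  have h1 : Integrable (fun ω => ∑ i, ∑ j, |grad f (W t ω) i j|) μ :=
    integrable_finsetSum _ fun i _ => integrable_finsetSum _ fun j _ =>
      (h.integrable_grad t i j).abs
  refine h1.mono (measurable_comp_of_continuous continuous_frobNorm fun i j =>
    (h.measurable_grad hf t i j).mono (ℱ.le _) le_rfl).aestronglyMeasurable
    (.of_forall fun ω => ?_)
  rw [Real.norm_of_nonneg (frobNorm_nonneg _), Real.norm_of_nonneg (by positivity)]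
  exact frobNorm_le_sum_abs _

theorem IsStochasticGradient.integrable_kyFanNorm_grad (h : IsStochasticGradient μ ℱ f W G v)
    (hf : IsLSmooth f L) {k : ℕ} (hk : k ≤ min m n) (t : ℕ) :
    Integrable (fun ω => kyFanNorm k (grad f (W t ω))) μ := by
  refine ((h.integrable_frobNorm_grad hf t).const_mul √k).mono
    (measurable_comp_of_continuous (continuous_kyFanNorm hk) fun i j =>
      (h.measurable_grad hf t i j).mono (ℱ.le _) le_rfl).aestronglyMeasurable
    (.of_forall fun ω => ?_)
  rw [Real.norm_of_nonneg (kyFanNorm_nonneg _),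
    Real.norm_of_nonneg (mul_nonneg (Real.sqrt_nonneg _) (frobNorm_nonneg _))]
  exact kyFanNorm_le_frobNorm hk _

/-- `f (W t)` itself need not be integrable. Its increments are, because a bounded step changes `f`
by at most a multiple of the gradient norm plus a constant. -/
theorem IsStochasticGradient.integrable_sub_succ [IsFiniteMeasure μ]
    (h : IsStochasticGradient μ ℱ f W G v)
    (hf : IsLSmooth f L) (hL : 0 ≤ L) {c : ℝ} (t : ℕ)
    (hW : ∀ ω, frobNorm (W (t + 1) ω - W t ω) ≤ c) :
    Integrable (fun ω => f (W t ω) - f (W (t + 1) ω)) μ := by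
  have hm : ∀ s, Measurable fun ω => f (W s ω) := fun s =>
    measurable_comp_of_continuous hf.continuous fun i j =>
      (h.iterate_measurable s i j).mono (ℱ.le _) le_rfl
  refine (((h.integrable_frobNorm_grad hf t).mul_const c).add
    (integrable_const (L / 2 * c ^ 2))).mono' ((hm t).sub (hm (t + 1))).aestronglyMeasurable
    (.of_forall fun ω => ?_)
  have h1 := hf.abs_sub_le (W t ω) (W (t + 1) ω - W t ω)
  rw [add_sub_cancel] at h1
  rw [Real.norm_eq_abs, abs_sub_comm]
  refine h1.trans ?_
  have h2 := frobNorm_nonneg (W (t + 1) ω - W t ω)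
  have h3 := frobNorm_nonneg (grad f (W t ω))
  have h4 := hW ω
  simp only [Pi.add_apply]
  gcongr

end StochasticGradient

/-! ### The pathwise bound and its expectation. -/

section Run

variable {m n k : ℕ} {Ω : Type*} {mΩ : MeasurableSpace Ω} {μ : Measure Ω} [IsProbabilityMeasure μ]
  {ℱ : Filtration ℕ mΩ} {f : Matrix (Fin m) (Fin n) ℝ → ℝ}
  {W G : ℕ → Ω → Matrix (Fin m) (Fin n) ℝ} {v L β γ : ℝ}

theorem IsNuMuonRun.frobNorm_sub_succ {G W : ℕ → Matrix (Fin m) (Fin n) ℝ} (hγ : 0 < γ)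
    (h : IsNuMuonRun k β γ G W) (t : ℕ) : frobNorm (W t - W (t + 1)) = γ * √k := by
  obtain ⟨U, V, hUV, hW⟩ := h t
  rw [hW, sub_sub_cancel, frobNorm_smul, abs_of_pos hγ,
    frobNorm_mul_transpose hUV.left_orthonormal hUV.right_orthonormal]

theorem IsNuMuonRun.kyFanNorm_grad_le {G W : ℕ → Matrix (Fin m) (Fin n) ℝ} (hk : k ≤ min m n)
    (hf : IsLSmooth f L) (hβ₀ : 0 ≤ β) (hβ₁ : β < 1) (hγ : 0 < γ)
    (h : IsNuMuonRun k β γ G W) (t : ℕ) :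
    kyFanNorm k (grad f (W t)) ≤ (f (W t) - f (W (t + 1))) / γ + L * k * γ / 2 +
      2 * √k * frobNorm (momentum β (fun s => G s - grad f (W s)) t) +
        2 * k * γ * β * L / (1 - β) := by
  obtain ⟨U, V, hUV, hW⟩ := h t
  have h1 := hf.kyFanNorm_grad_le hk hγ (W := W t) hUV
  rw [← hW] at h1
  -- Every step has length exactly `γ * √k`, so the true gradients drift by at most `L * (γ * √k)`.
  have h2 := frobNorm_momentum_sub_le hβ₀ hβ₁ (H := fun s => grad f (W s)) (c := L * (γ * √k))
    (fun s => by
      rw [← h.frobNorm_sub_succ hγ s]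
      exact hf.frobNorm_grad_sub_le _ _) t
  have h3 := frobNorm_add_le (momentum β (fun s => G s - grad f (W s)) t)
    (momentum β (fun s => grad f (W s)) t - grad f (W t))
  rw [momentum_sub, sub_add_sub_cancel, ← momentum_sub] at h3
  have h4 := mul_le_mul_of_nonneg_left (h3.trans (add_le_add_right h2 _))
    (mul_nonneg zero_le_two (Real.sqrt_nonneg (k : ℝ)))
  have h5 : 2 * √k * (β * (L * (γ * √k)) / (1 - β)) = 2 * k * γ * β * L / (1 - β) := by
    rw [mul_div_assoc']
    congr 1
    linear_combination 2 * β * L * γ * Real.mul_self_sqrt (Nat.cast_nonneg (α := ℝ) k)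
  rw [mul_add, h5] at h4
  linarith

theorem integrable_sub_of_isNuMuonRun (hf : IsLSmooth f L) (hL : 0 ≤ L) (hγ : 0 < γ)
    (hsg : IsStochasticGradient μ ℱ f W G v)
    (hrun : ∀ ω, IsNuMuonRun k β γ (fun t => G t ω) fun t => W t ω) (t : ℕ) :
    Integrable (fun ω => f (W t ω) - f (W (t + 1) ω)) μ :=
  hsg.integrable_sub_succ hf hL t fun ω => by
    rw [frobNorm_sub_comm]
    exact ((hrun ω).frobNorm_sub_succ hγ t).le

theorem integrable_sub_zero_of_isNuMuonRun (hf : IsLSmooth f L) (hL : 0 ≤ L) (hγ : 0 < γ)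
    (hsg : IsStochasticGradient μ ℱ f W G v)
    (hrun : ∀ ω, IsNuMuonRun k β γ (fun t => G t ω) fun t => W t ω) (T : ℕ) :
    Integrable (fun ω => f (W 0 ω) - f (W T ω)) μ := by
  simp only [← fun ω => Finset.sum_range_sub' (fun t => f (W t ω)) T]
  exact integrable_finsetSum _ fun t _ => integrable_sub_of_isNuMuonRun hf hL hγ hsg hrun t

theorem sum_integral_kyFanNorm_grad_le (hk : k ≤ min m n) (hf : IsLSmooth f L) (hL : 0 ≤ L)
    (hβ₀ : 0 ≤ β) (hβ₁ : β < 1) (hγ : 0 < γ) (hv : 0 ≤ v)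
    (hsg : IsStochasticGradient μ ℱ f W G v)
    (hrun : ∀ ω, IsNuMuonRun k β γ (fun t => G t ω) fun t => W t ω) (T : ℕ) :
    ∑ t ∈ Finset.range T, ∫ ω, kyFanNorm k (grad f (W t ω)) ∂μ ≤
      (∫ ω, (f (W 0 ω) - f (W T ω)) ∂μ) / γ + T * (L * k * γ / 2) +
        2 * √k * (√v * (T * √((1 - β) / (1 + β)) + β / (1 - β))) +
          T * (2 * k * γ * β * L / (1 - β)) := by
  let N : ℕ → Ω → Matrix (Fin m) (Fin n) ℝ := fun t ω =>
    momentum β (fun s => G s ω - grad f (W s ω)) t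
  have hN : ∀ t, Integrable (fun ω => frobNorm (N t ω)) μ := fun t =>
    (memLp_frobNorm (fun i j => (measurable_momentum (hsg.measurable_sub hf) t i j).mono
      (ℱ.le _) le_rfl) (memLp_momentum (hsg.memLp_sub hf) t)).integrable one_le_two
  have hsub := integrable_sub_of_isNuMuonRun hf hL hγ hsg hrun
  have hstep : ∀ t, ∫ ω, kyFanNorm k (grad f (W t ω)) ∂μ ≤
      (∫ ω, (f (W t ω) - f (W (t + 1) ω)) ∂μ) / γ + L * k * γ / 2 +
        2 * √k * ∫ ω, frobNorm (N t ω) ∂μ + 2 * k * γ * β * L / (1 - β) := fun t => by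
    have i1 : Integrable (fun ω => (f (W t ω) - f (W (t + 1) ω)) / γ + L * k * γ / 2) μ :=
      ((hsub t).div_const γ).add (integrable_const _)
    have i2 : Integrable (fun ω => (f (W t ω) - f (W (t + 1) ω)) / γ + L * k * γ / 2 +
        2 * √k * frobNorm (N t ω)) μ := i1.add ((hN t).const_mul _)
    have h := integral_mono (hsg.integrable_kyFanNorm_grad hf hk t)
      (i2.add (integrable_const (2 * k * γ * β * L / (1 - β))))
      fun ω => (hrun ω).kyFanNorm_grad_le hk hf hβ₀ hβ₁ hγ t
    refine h.trans_eq ?_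
    simp only [Pi.add_apply]
    rw [integral_add i2 (integrable_const _), integral_add i1 ((hN t).const_mul _),
      integral_add ((hsub t).div_const γ) (integrable_const _), integral_div, integral_const_mul]
    simp
  have hnoise := sum_integral_frobNorm_momentum_le hβ₀ hβ₁ hv (hsg.measurable_sub hf)
    (hsg.memLp_sub hf) (hsg.condExp_sub hf) hsg.variance_le T
  have htel : ∑ t ∈ Finset.range T, ∫ ω, (f (W t ω) - f (W (t + 1) ω)) ∂μ =
      ∫ ω, (f (W 0 ω) - f (W T ω)) ∂μ := by
    rw [← integral_finsetSum _ fun t _ => hsub t]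
    simp only [fun ω => Finset.sum_range_sub' (fun t => f (W t ω)) T]
  refine (Finset.sum_le_sum fun t _ => hstep t).trans ?_
  rw [Finset.sum_add_distrib, Finset.sum_add_distrib, Finset.sum_add_distrib, ← Finset.sum_div,
    htel, ← Finset.mul_sum, Finset.sum_const, Finset.sum_const, Finset.card_range, nsmul_eq_mul,
    nsmul_eq_mul]
  gcongr

end Run

end NuMuon

/-! ### The stationarity bounds. -/

theorem theorem1 {m n k b T : ℕ} {Ω Ξ : Type*} {mΩ : MeasurableSpace Ω}
    (μ : Measure Ω) [IsProbabilityMeasure μ] (ℱ : Filtration ℕ mΩ)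
    (hk : 1 ≤ k) (hkq : k ≤ min m n) (hb : 1 ≤ b) (hT : 1 ≤ T)
    {L ν β γ : ℝ} (hν : 0 ≤ ν) (hβ₀ : 0 ≤ β) (hβ₁ : β < 1) (hγ : 0 < γ)
    (f : Matrix (Fin m) (Fin n) ℝ → ℝ) (hf : NuMuon.IsLSmooth f L)
    (g : Matrix (Fin m) (Fin n) ℝ → Ξ → Matrix (Fin m) (Fin n) ℝ)
    (ξ : ℕ → Fin b → Ω → Ξ)
    (W G : ℕ → Ω → Matrix (Fin m) (Fin n) ℝ)
    (hG : ∀ t ω, G t ω = NuMuon.batchGradient g (W t ω) fun i => ξ t i ω)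
    (hsg : NuMuon.IsStochasticGradient μ ℱ f W G (ν ^ 2 / b))
    (hrun : ∀ ω, NuMuon.IsNuMuonRun k β γ (fun t => G t ω) fun t => W t ω) :
    Integrable (fun ω => f (W 0 ω) - f (W T ω)) μ ∧
    (∀ t < T, Integrable (fun ω => NuMuon.kyFanNorm k (NuMuon.grad f (W t ω))) μ) ∧
    (∀ t < T, Integrable (fun ω => NuMuon.nuclearNorm (NuMuon.grad f (W t ω))) μ) ∧
    (1 / (T : ℝ) * ∑ t ∈ Finset.range T,
        ∫ ω, NuMuon.kyFanNorm k (NuMuon.grad f (W t ω)) ∂μ ≤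
      (∫ ω, (f (W 0 ω) - f (W T ω)) ∂μ) / (T * γ) + L * k * γ / 2
        + 2 * ν * √(k * (1 - β)) / √((1 + β) * b)
        + 2 * β * ν * √k / ((1 - β) * T * √b)
        + 2 * k * γ * β * L / (1 - β)) ∧
    ∀ (δ : ℝ) (R : ℕ → Ω → Matrix (Fin m) (Fin n) ℝ),
      (∀ t < T, ∀ ω, NuMuon.IsRankTruncation k (NuMuon.grad f (W t ω)) (R t ω)) →
      (∀ t < T, ∫ ω, NuMuon.nuclearNorm (NuMuon.grad f (W t ω) - R t ω) ∂μ ≤ δ) →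
      1 / (T : ℝ) * ∑ t ∈ Finset.range T,
          ∫ ω, NuMuon.nuclearNorm (NuMuon.grad f (W t ω)) ∂μ ≤
        (∫ ω, (f (W 0 ω) - f (W T ω)) ∂μ) / (T * γ) + L * k * γ / 2
          + 2 * ν * √(k * (1 - β)) / √((1 + β) * b)
          + 2 * β * ν * √k / ((1 - β) * T * √b)
          + 2 * k * γ * β * L / (1 - β) + δ := by
  have hm : 0 < m := hk.trans (hkq.trans (min_le_left m n))
  have hn : 0 < n := hk.trans (hkq.trans (min_le_right m n))
  have hL : 0 ≤ L := hf.nonneg hm hn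
  have hT0 : (0 : ℝ) < T := by exact_mod_cast hT
  have hb0 : (0 : ℝ) < b := by exact_mod_cast hb
  have hβ : 0 < 1 - β := sub_pos.2 hβ₁
  have hkf := fun t => hsg.integrable_kyFanNorm_grad hf hkq t
  -- The nuclear norm is the Ky Fan norm with `k = min m n`.
  have hnuc : ∀ t, Integrable (fun ω => NuMuon.nuclearNorm (NuMuon.grad f (W t ω))) μ :=
    fun t => hsg.integrable_kyFanNorm_grad hf le_rfl t
  have hmain : 1 / (T : ℝ) * ∑ t ∈ Finset.range T,
        ∫ ω, NuMuon.kyFanNorm k (NuMuon.grad f (W t ω)) ∂μ ≤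
      (∫ ω, (f (W 0 ω) - f (W T ω)) ∂μ) / (T * γ) + L * k * γ / 2
        + 2 * ν * √(k * (1 - β)) / √((1 + β) * b)
        + 2 * β * ν * √k / ((1 - β) * T * √b)
        + 2 * k * γ * β * L / (1 - β) := by
    have h := NuMuon.sum_integral_kyFanNorm_grad_le hkq hf hL hβ₀ hβ₁ hγ
      (div_nonneg (sq_nonneg ν) hb0.le) hsg hrun T
    have hsb := (Real.sqrt_pos.2 hb0).ne'
    have hsβ := (Real.sqrt_pos.2 (show 0 < 1 + β by linarith)).ne'
    rw [Real.sqrt_div (sq_nonneg ν), Real.sqrt_sq hν, Real.sqrt_div hβ.le] at h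
    rw [Real.sqrt_mul k.cast_nonneg, Real.sqrt_mul (by linarith : (0 : ℝ) ≤ 1 + β)]
    refine (mul_le_mul_of_nonneg_left h (by positivity)).trans_eq ?_
    field_simp
    ring
  refine ⟨NuMuon.integrable_sub_zero_of_isNuMuonRun hf hL hγ hsg hrun T, fun t _ => hkf t,
    fun t _ => hnuc t, hmain, fun δ R hR hδ => ?_⟩
  have hsum : ∑ t ∈ Finset.range T, ∫ ω, NuMuon.nuclearNorm (NuMuon.grad f (W t ω)) ∂μ ≤
      ∑ t ∈ Finset.range T, ∫ ω, NuMuon.kyFanNorm k (NuMuon.grad f (W t ω)) ∂μ + T * δ := by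
    have hterm : ∀ t ∈ Finset.range T, ∫ ω, NuMuon.nuclearNorm (NuMuon.grad f (W t ω)) ∂μ ≤
        ∫ ω, NuMuon.kyFanNorm k (NuMuon.grad f (W t ω)) ∂μ + δ := fun t ht => by
      have ht := Finset.mem_range.1 ht
      have h := hδ t ht
      -- The truncation residual depends only on the gradient, so no measurable choice of `R` is
      -- needed.
      simp only [fun ω => (hR t ht ω).nuclearNorm_sub] at h
      rw [integral_sub (hnuc t) (hkf t)] at h
      linarith
    refine (Finset.sum_le_sum hterm).trans_eq ?_
    simp [Finset.sum_add_distrib]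
  have h := mul_le_mul_of_nonneg_left hsum (one_div_nonneg.2 hT0.le)
  rw [mul_add, ← mul_assoc, one_div_mul_cancel hT0.ne', one_mul] at h
  linarith
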